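/- There is an absolute constant $c>0$ such that the following holds for all $n$ and $M$. Let $X\subseteq [M]^n$ be symmetric (if $x\in X$ and $\sigma\in S_n$, then $x_\sigma=(x_{\sigma(1)},\dots,x_{\sigma(n)})\in X$) and let $f:X\to\{0,1\}$ be symmetric ($f(x_\sigma)=f(x)$ for all $x\in X$, $\sigma\in S_n$). The type $\tau(x)$ of $x\in[M]^n$ is the multiset $\{x_1,\dots,x_n\}$, and the distance $d(S,T)$ between two types is the maximum over $i\in[M]$ of the absolute difference between the multiplicities of $i$ in $S$ and in $T$. Let $$d(f)=\min\{d(\tau(x),\tau(y)) : x,y\in X,\ f(x)\neq f(y)\},\qquad g(f)=\frac{n}{d(f)},$$ with $d(f)=\infty$ and $g(f)=0$ if $f$ is constant. Let $Q(f)$ be the bounded-error quantum query complexity of $f$, that is, the least number of queries $|i,b\rangle\mapsto|i,b+x_i \bmod M\rangle$ made by a quantum algorithm that, for every $x\in X$, outputs $f(x)$ with probability at least $2/3$. Then $$Q(f)\ \ge\ c\,\frac{g(f)^{1/4}}{M}.$$ -/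

import Mathlib

open scoped ENNReal

noncomputable section

namespace QuantumQuery

/-! ### Symmetric partial functions, types, the distance `d(f)` and the measure `g(f)`

Inputs are the words `x : Fin n → Fin M`, the promise is a set `X` of inputs, and a partial
Boolean function with promise `X` is a map `f : X → Bool`. -/

/-- `X` is symmetric: it is closed under permuting the positions of an input. -/
def IsSymmetricPromise {n M : ℕ} (X : Set (Fin n → Fin M)) : Prop :=
  ∀ x ∈ X, ∀ σ : Equiv.Perm (Fin n), x ∘ σ ∈ X

/-- `f` is symmetric: it is invariant under permuting the positions of an input. -/
def IsSymmetricFun {n M : ℕ} {X : Set (Fin n → Fin M)} (f : X → Bool) : Prop :=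
  ∀ (x y : X) (σ : Equiv.Perm (Fin n)), (y : Fin n → Fin M) = (x : Fin n → Fin M) ∘ σ → f y = f x

/-- The type of an input: the multiset of its entries. -/
def inputType {n M : ℕ} (x : Fin n → Fin M) : Multiset (Fin M) :=
  Finset.univ.val.map x

/-- The distance of two types: the largest absolute difference of the multiplicities
of a letter. -/
def typeDist {M : ℕ} (S T : Multiset (Fin M)) : ℕ :=
  Finset.univ.sup fun i : Fin M => ((S.count i : ℤ) - (T.count i : ℤ)).natAbs

/-- `d(f)`: the least distance between the types of two inputs in the promise on which `f` takes
different values (`⊤` if `f` is constant). -/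
def minTypeDist {n M : ℕ} {X : Set (Fin n → Fin M)} (f : X → Bool) : ℕ∞ :=
  ⨅ (x : X) (y : X) (_ : f x ≠ f y), (typeDist (inputType x.1) (inputType y.1) : ℕ∞)

/-- `g(f) = n / d(f)` (equal to `0` if `f` is constant). -/
def gMeasure {n M : ℕ} {X : Set (Fin n → Fin M)} (f : X → Bool) : ℝ≥0∞ :=
  (n : ℝ≥0∞) / (minTypeDist f : ℝ≥0∞)

/-! ### Quantum query algorithms -/

/-- The computational basis: an index register, an answer register and a `w`-dimensional
workspace. The basis state `(i, b, z)` is `|i⟩|b⟩|z⟩`. -/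
abbrev Basis (n M w : ℕ) : Type := Fin n × Fin M × Fin w

/-- The query operator `|i⟩|b⟩|z⟩ ↦ |i⟩|b + x i mod M⟩|z⟩`, acting on amplitude vectors: the new
amplitude of `|i⟩|b⟩|z⟩` is the old amplitude of `|i⟩|b - x i mod M⟩|z⟩`. -/
def oracle {n M w : ℕ} (x : Fin n → Fin M) (ψ : Basis n M w → ℂ) : Basis n M w → ℂ :=
  fun s => ψ (s.1, s.2.1 - x s.1, s.2.2)

/-- A quantum algorithm that makes `T` queries: a workspace of finite dimension, an initial basis
state, the input-independent unitaries `U 0, …, U T`, and the bit to output on each outcome of the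
final measurement in the computational basis. -/
structure Algorithm (n M T : ℕ) where
  w : ℕ
  start : Basis n M w
  U : ℕ → Matrix.unitaryGroup (Basis n M w) ℂ
  output : Basis n M w → Bool

/-- The state `U k · O_x · U (k-1) · ⋯ · O_x · U 0 |start⟩` after `k` queries to the input `x`. -/
def Algorithm.state {n M T : ℕ} (A : Algorithm n M T) (x : Fin n → Fin M) :
    ℕ → (Basis n M A.w → ℂ)
  | 0 => (A.U 0).1.mulVec (Pi.single A.start 1)
  | k + 1 => (A.U (k + 1)).1.mulVec (oracle x (A.state x k))

/-- The probability that the algorithm outputs the bit `b` on input `x`, after its `T` queries. -/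
def Algorithm.prob {n M T : ℕ} (A : Algorithm n M T) (x : Fin n → Fin M) (b : Bool) : ℝ :=
  ∑ s : Basis n M A.w, if A.output s = b then ‖A.state x T s‖ ^ 2 else 0

/-- The algorithm computes `f` with error probability at most `1/3` on each input in the promise. -/
def Algorithm.Computes {n M T : ℕ} (A : Algorithm n M T) {X : Set (Fin n → Fin M)}
    (f : X → Bool) : Prop :=
  ∀ x : X, 2 / 3 ≤ A.prob x.1 (f x)

/-- The bounded-error quantum query complexity `Q(f)`: the least number of queries of a quantum
algorithm that computes `f`. -/
def quantumQueryComplexity {n M : ℕ} {X : Set (Fin n → Fin M)} (f : X → Bool) : ℕ∞ :=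
  ⨅ (T : ℕ) (_ : ∃ A : Algorithm n M T, A.Computes f), (T : ℕ∞)

end QuantumQuery

end

namespace QuantumQuery

open Finset

/-! ### The Euclidean norm of amplitude vectors -/

/-! This is a hybrid argument. Let `f` differ on `x` and `y`, at type distance `d`. A permutation
aligns `y` with `x` outside a set `E` of at most `M * d` positions (`exists_perm_card_disagree_le`).
Some letter `c` fills at least `n / M` positions of `x`; overwriting `E` by `c` gives a hybrid `z`,
equal to `c` on a set `C ⊇ E`. In the run on `z` the total query weight is `T`, so some `D ⊆ C` with
`#D = #E` has weight at most `M² d T / n`. Permutations inside `C` fix `z`, and one of them carries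
`D` to `E`; hence permuted copies of `x` and `y` both agree with `z` off `D`, and their final states
are close. Symmetry of `f` and correctness keep these states at least `1/5` apart, so `n ≤ (20TM)²
d`. This gives the exponent `1/2`, which is stronger than `1/4`. -/

/-- The Euclidean norm of an amplitude vector. -/
noncomputable def amplNorm {ι : Type*} [Fintype ι] (ψ : ι → ℂ) : ℝ :=
  ‖(WithLp.toLp 2 ψ : EuclideanSpace ℂ ι)‖

section AmplNorm

variable {ι : Type*} [Fintype ι]

theorem amplNorm_nonneg (ψ : ι → ℂ) : 0 ≤ amplNorm ψ := norm_nonneg _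

theorem amplNorm_sq (ψ : ι → ℂ) : amplNorm ψ ^ 2 = ∑ s, ‖ψ s‖ ^ 2 :=
  EuclideanSpace.norm_sq_eq _

theorem amplNorm_add_le (φ ψ : ι → ℂ) : amplNorm (φ + ψ) ≤ amplNorm φ + amplNorm ψ :=
  norm_add_le (WithLp.toLp 2 φ : EuclideanSpace ℂ ι) (WithLp.toLp 2 ψ)

theorem amplNorm_sub_rev (φ ψ : ι → ℂ) : amplNorm (φ - ψ) = amplNorm (ψ - φ) :=
  norm_sub_rev (WithLp.toLp 2 φ : EuclideanSpace ℂ ι) (WithLp.toLp 2 ψ)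

theorem amplNorm_mulVec_unitary [DecidableEq ι] (U : Matrix.unitaryGroup ι ℂ) (ψ : ι → ℂ) :
    amplNorm (U.1.mulVec ψ) = amplNorm ψ := by
  have key : ∀ φ : ι → ℂ, ((amplNorm φ ^ 2 : ℝ) : ℂ) = star φ ⬝ᵥ φ := by
    intro φ
    rw [amplNorm_sq]
    push_cast
    refine Finset.sum_congr rfl fun s _ => ?_
    rw [Pi.star_apply, RCLike.star_def, Complex.conj_mul']
  have h : ((amplNorm (U.1.mulVec ψ) ^ 2 : ℝ) : ℂ) = ((amplNorm ψ ^ 2 : ℝ) : ℂ) := by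
    rw [key, key, Matrix.star_mulVec, Matrix.dotProduct_mulVec, Matrix.vecMul_vecMul]
    have hU : U.1.conjTranspose * U.1 = 1 := Matrix.UnitaryGroup.star_mul_self U
    rw [hU, Matrix.vecMul_one]
  have h' := Complex.ofReal_injective h
  exact (sq_eq_sq₀ (amplNorm_nonneg _) (amplNorm_nonneg _)).1 h'

end AmplNorm

/-! ### The hybrid argument -/

section Hybrid

variable {n M w : ℕ}

/-- The probability of finding the index register in position `i`. -/
noncomputable def indexWeight (ψ : Basis n M w → ℂ) (i : Fin n) : ℝ :=
  ∑ p : Fin M × Fin w, ‖ψ (i, p)‖ ^ 2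

theorem indexWeight_nonneg (ψ : Basis n M w → ℂ) (i : Fin n) : 0 ≤ indexWeight ψ i :=
  Finset.sum_nonneg fun _ _ => sq_nonneg _

theorem sum_indexWeight (ψ : Basis n M w → ℂ) : ∑ i, indexWeight ψ i = amplNorm ψ ^ 2 := by
  rw [amplNorm_sq, Fintype.sum_prod_type]
  rfl

theorem oracle_sub (x : Fin n → Fin M) (φ ψ : Basis n M w → ℂ) :
    oracle x (φ - ψ) = oracle x φ - oracle x ψ := rfl

theorem indexWeight_oracle (x : Fin n → Fin M) (ψ : Basis n M w → ℂ) (i : Fin n) :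
    indexWeight (oracle x ψ) i = indexWeight ψ i := by
  have : NeZero M := ⟨fun h => (Fin.cast h (x i)).elim0⟩
  exact Fintype.sum_equiv ((Equiv.subRight (x i)).prodCongr (Equiv.refl (Fin w))) _ _
    fun p => rfl

theorem amplNorm_oracle (x : Fin n → Fin M) (ψ : Basis n M w → ℂ) :
    amplNorm (oracle x ψ) = amplNorm ψ := by
  have h : amplNorm (oracle x ψ) ^ 2 = amplNorm ψ ^ 2 := by
    rw [← sum_indexWeight, ← sum_indexWeight]
    exact Finset.sum_congr rfl fun i _ => indexWeight_oracle x ψ i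
  exact (sq_eq_sq₀ (amplNorm_nonneg _) (amplNorm_nonneg _)).1 h

/-- Off `D` the two oracles act identically. On `D`, use `‖a - b‖² ≤ 2‖a‖² + 2‖b‖²`; each oracle
preserves index weights. -/
theorem amplNorm_oracle_sub_oracle_sq_le (x z : Fin n → Fin M) (D : Finset (Fin n))
    (h : ∀ i, i ∉ D → x i = z i) (ψ : Basis n M w → ℂ) :
    amplNorm (oracle x ψ - oracle z ψ) ^ 2 ≤ 4 * ∑ i ∈ D, indexWeight ψ i := by
  rw [← sum_indexWeight, Finset.mul_sum, ← Finset.sum_subset (Finset.subset_univ D)]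
  · refine Finset.sum_le_sum fun i _ => ?_
    have hle : indexWeight (oracle x ψ - oracle z ψ) i ≤
        2 * indexWeight (oracle x ψ) i + 2 * indexWeight (oracle z ψ) i := by
      unfold indexWeight
      rw [Finset.mul_sum, Finset.mul_sum, ← Finset.sum_add_distrib]
      refine Finset.sum_le_sum fun p _ => ?_
      have h1 := norm_sub_le (oracle x ψ (i, p)) (oracle z ψ (i, p))
      have h2 := norm_nonneg (oracle x ψ (i, p) - oracle z ψ (i, p))
      rw [Pi.sub_apply]
      nlinarith [sq_nonneg (‖oracle x ψ (i, p)‖ - ‖oracle z ψ (i, p)‖)]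
    rw [indexWeight_oracle, indexWeight_oracle] at hle
    linarith
  · intro i _ hi
    refine Finset.sum_eq_zero fun p _ => ?_
    simp [oracle, h i hi]

variable {T : ℕ} (A : Algorithm n M T)

theorem Algorithm.amplNorm_state (x : Fin n → Fin M) (k : ℕ) : amplNorm (A.state x k) = 1 := by
  induction k with
  | zero =>
    rw [Algorithm.state, amplNorm_mulVec_unitary, amplNorm, ← PiLp.single]
    simp
  | succ k ih => rw [Algorithm.state, amplNorm_mulVec_unitary, amplNorm_oracle, ih]

/-- Unitarity carries the old error along unchanged; each query adds only the discrepancy of the two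
oracles on the state of the `z`-run. Thus a single run, on `z`, controls every `x`. -/
theorem Algorithm.amplNorm_state_sub_le (x z : Fin n → Fin M) (k : ℕ) :
    amplNorm (A.state x k - A.state z k) ≤
      ∑ j ∈ range k, amplNorm (oracle x (A.state z j) - oracle z (A.state z j)) := by
  induction k with
  | zero =>
    have : A.state x 0 - A.state z 0 = 0 := sub_self ((A.U 0).1.mulVec (Pi.single A.start 1))
    rw [this]
    simp [amplNorm]
  | succ k ih =>
    rw [Algorithm.state, Algorithm.state, ← Matrix.mulVec_sub, amplNorm_mulVec_unitary,
      Finset.sum_range_succ]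
    have hsplit : oracle x (A.state x k) - oracle z (A.state z k) =
        oracle x (A.state x k - A.state z k) +
          (oracle x (A.state z k) - oracle z (A.state z k)) := by
      rw [oracle_sub]; abel
    rw [hsplit]
    refine (amplNorm_add_le _ _).trans ?_
    rw [amplNorm_oracle]
    linarith

/-- The total weight that the queries of an algorithm on input `z` put on position `i`. -/
noncomputable def Algorithm.queryWeight (z : Fin n → Fin M) (i : Fin n) : ℝ :=
  ∑ j ∈ range T, indexWeight (A.state z j) i

theorem Algorithm.queryWeight_nonneg (z : Fin n → Fin M) (i : Fin n) :
    0 ≤ A.queryWeight z i :=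
  Finset.sum_nonneg fun _ _ => indexWeight_nonneg _ _

theorem Algorithm.sum_queryWeight (z : Fin n → Fin M) : ∑ i, A.queryWeight z i = T := by
  unfold Algorithm.queryWeight
  rw [Finset.sum_comm]
  simp [sum_indexWeight, A.amplNorm_state]

/-- The hybrid bound: inputs that differ only on positions of small query weight lead to close
final states. -/
theorem Algorithm.amplNorm_state_sub_sq_le (x z : Fin n → Fin M) (D : Finset (Fin n))
    (h : ∀ i, i ∉ D → x i = z i) :
    amplNorm (A.state x T - A.state z T) ^ 2 ≤ 4 * T * ∑ i ∈ D, A.queryWeight z i := by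
  calc amplNorm (A.state x T - A.state z T) ^ 2
      ≤ (∑ j ∈ range T, amplNorm (oracle x (A.state z j) - oracle z (A.state z j))) ^ 2 :=
        pow_le_pow_left₀ (amplNorm_nonneg _) (A.amplNorm_state_sub_le x z T) 2
    _ ≤ T * ∑ j ∈ range T, amplNorm (oracle x (A.state z j) - oracle z (A.state z j)) ^ 2 := by
        simpa using sq_sum_le_card_mul_sum_sq (s := range T)
          (f := fun j => amplNorm (oracle x (A.state z j) - oracle z (A.state z j)))
    _ ≤ T * ∑ j ∈ range T, 4 * ∑ i ∈ D, indexWeight (A.state z j) i := by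
        gcongr with j
        exact amplNorm_oracle_sub_oracle_sq_le x z D h _
    _ = 4 * T * ∑ i ∈ D, A.queryWeight z i := by
        unfold Algorithm.queryWeight
        rw [Finset.sum_comm (s := D), ← Finset.mul_sum]
        ring

/-! ### Distinguishing inputs forces the final states apart -/

theorem Algorithm.prob_add_prob_not (x : Fin n → Fin M) (b : Bool) :
    A.prob x b + A.prob x (!b) = 1 := by
  have h := amplNorm_sq (A.state x T)
  rw [A.amplNorm_state] at h
  unfold Algorithm.prob
  rw [← Finset.sum_add_distrib, ← one_pow 2, h]
  refine Finset.sum_congr rfl fun s _ => ?_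
  cases A.output s <;> cases b <;> simp

theorem Algorithm.one_fifth_le_amplNorm_sub (x y : Fin n → Fin M) (b : Bool)
    (hx : 2 / 3 ≤ A.prob x b) (hy : 2 / 3 ≤ A.prob y (!b)) :
    1 / 5 ≤ amplNorm (A.state x T - A.state y T) := by
  have hy' : A.prob y b ≤ 1 / 3 := by linarith [A.prob_add_prob_not y b]
  let P : (Basis n M A.w → ℂ) → Basis n M A.w → ℂ := fun ψ s => if A.output s = b then ψ s else 0
  have hP : ∀ v, amplNorm (P (A.state v T)) ^ 2 = A.prob v b := by
    intro v
    rw [amplNorm_sq]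
    refine Finset.sum_congr rfl fun s _ => ?_
    by_cases hs : A.output s = b <;> simp [P, hs]
  have hPle : amplNorm (P (A.state x T - A.state y T)) ≤
      amplNorm (A.state x T - A.state y T) := by
    refine (sq_le_sq₀ (amplNorm_nonneg _) (amplNorm_nonneg _)).1 ?_
    rw [amplNorm_sq, amplNorm_sq]
    refine Finset.sum_le_sum fun s _ => ?_
    by_cases hs : A.output s = b
    · simp [P, hs]
    · simp [P, hs]
  have hadd : amplNorm (P (A.state x T)) ≤
      amplNorm (P (A.state x T - A.state y T)) + amplNorm (P (A.state y T)) := by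
    refine le_trans (le_of_eq ?_) (amplNorm_add_le _ _)
    congr 1
    ext s
    by_cases hs : A.output s = b <;> simp [P, hs]
  -- Rational bounds: `(4/5)² ≤ 2/3` and `1/3 ≤ (3/5)²`.
  have h1 : 4 / 5 ≤ amplNorm (P (A.state x T)) := by
    refine (sq_le_sq₀ (by norm_num) (amplNorm_nonneg _)).1 ?_
    rw [hP]; linarith
  have h2 : amplNorm (P (A.state y T)) ≤ 3 / 5 := by
    refine (sq_le_sq₀ (amplNorm_nonneg _) (by norm_num)).1 ?_
    rw [hP]; linarith
  linarith

end Hybrid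

/-! ### Combinatorics of inputs -/

/-- Discarding a heaviest element never raises the average, so repeat until `k` elements remain. -/
theorem exists_subset_card_eq_sum_le {α : Type*} [DecidableEq α] (q : α → ℝ) (k : ℕ)
    (C : Finset α) (hk : k ≤ #C) :
    ∃ D ⊆ C, #D = k ∧ (#C : ℝ) * ∑ i ∈ D, q i ≤ k * ∑ i ∈ C, q i := by
  obtain ⟨m, hm⟩ := Nat.exists_eq_add_of_le hk
  induction m generalizing C with
  | zero => exact ⟨C, Subset.rfl, by simpa using hm, by simp [hm]⟩
  | succ m ih =>
    have hne : C.Nonempty := Finset.card_pos.1 (by omega)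
    obtain ⟨a, ha, hmax⟩ := C.exists_max_image q hne
    have hcard : #(C.erase a) = k + m := by rw [Finset.card_erase_of_mem ha]; omega
    obtain ⟨D, hD, hDk, hle⟩ := ih (C.erase a) (by omega) hcard
    refine ⟨D, hD.trans (Finset.erase_subset _ _), hDk, ?_⟩
    have hDs : ∑ i ∈ D, q i ≤ k * q a := by
      have := Finset.sum_le_card_nsmul D q (q a)
        fun i hi => hmax i (Finset.erase_subset _ _ (hD hi))
      rwa [hDk, nsmul_eq_mul] at this
    have hC : (#C : ℝ) = #(C.erase a) + 1 := by
      rw [hcard, hm]; push_cast; ring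
    rw [← Finset.add_sum_erase C q ha, hC]
    linarith

/-- Two subsets of `C` of equal size are related by a permutation that fixes the complement
of `C`. -/
theorem exists_perm_maps_subset {α : Type*} [Fintype α] [DecidableEq α] {C D E : Finset α}
    (hD : D ⊆ C) (hE : E ⊆ C) (h : #D = #E) :
    ∃ π : Equiv.Perm α, (∀ i, i ∉ C → π i = i) ∧ (∀ i, π i ∈ C ↔ i ∈ C) ∧
      ∀ i, π i ∈ E ↔ i ∈ D := by
  have hcard : ∀ F : Finset α, F ⊆ C → Fintype.card {i : C // (i : α) ∈ F} = #F := by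
    intro F hF
    rw [← Fintype.card_coe F]
    exact Fintype.card_congr
      ⟨fun i => ⟨i.1.1, i.2⟩, fun i => ⟨⟨i.1, hF i.2⟩, i.2⟩, fun _ => rfl, fun _ => rfl⟩
  obtain ⟨e⟩ : Nonempty ({i : C // (i : α) ∈ D} ≃ {i : C // (i : α) ∈ E}) :=
    Fintype.card_eq.1 (by rw [hcard D hD, hcard E hE, h])
  have hin : ∀ i : C, ((e.extendSubtype i : C) : α) ∈ E ↔ (i : α) ∈ D := by
    intro i
    by_cases hi : (i : α) ∈ D
    · exact iff_of_true (e.extendSubtype_mem i hi) hi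
    · exact iff_of_false (e.extendSubtype_not_mem i hi) hi
  have hC : ∀ (i : α) (hi : i ∈ C),
      Equiv.Perm.ofSubtype (p := (· ∈ C)) e.extendSubtype i = (e.extendSubtype ⟨i, hi⟩ : C) :=
    fun i hi => Equiv.Perm.ofSubtype_apply_of_mem (p := (· ∈ C)) _ hi
  have hnC : ∀ (i : α), i ∉ C →
      Equiv.Perm.ofSubtype (p := (· ∈ C)) e.extendSubtype i = i :=
    fun i hi => Equiv.Perm.ofSubtype_apply_of_not_mem (p := (· ∈ C)) _ hi
  refine ⟨Equiv.Perm.ofSubtype (p := (· ∈ C)) e.extendSubtype, hnC, fun i => ?_, fun i => ?_⟩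
  · by_cases hi : i ∈ C
    · rw [hC i hi]; exact iff_of_true (Subtype.prop _) hi
    · rw [hnC i hi]
  · by_cases hi : i ∈ C
    · rw [hC i hi]; exact hin ⟨i, hi⟩
    · rw [hnC i hi]; exact iff_of_false (fun h => hi (hE h)) (fun h => hi (hD h))

section Types

variable {n M : ℕ}

theorem count_inputType (x : Fin n → Fin M) (a : Fin M) :
    (inputType x).count a = #{i | x i = a} := by
  rw [inputType, Multiset.count_map, Finset.card_def, Finset.filter_val]
  simp only [eq_comm]

theorem inputType_comp_perm (y : Fin n → Fin M) (σ : Equiv.Perm (Fin n)) :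
    inputType (y ∘ σ) = inputType y := by
  ext a
  rw [count_inputType, count_inputType]
  exact Finset.card_equiv σ (by simp)

theorem natAbs_count_sub_le_typeDist (S T : Multiset (Fin M)) (a : Fin M) :
    ((S.count a : ℤ) - (T.count a : ℤ)).natAbs ≤ typeDist S T :=
  Finset.le_sup (f := fun i : Fin M => ((S.count i : ℤ) - (T.count i : ℤ)).natAbs)
    (Finset.mem_univ a)

/-- Permuting `y` so that it agrees with `x` in as many positions as possible leaves at most
`M` times the distance of the types of `x` and `y` disagreements. -/
theorem exists_perm_card_disagree_le (x y : Fin n → Fin M) :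
    ∃ σ : Equiv.Perm (Fin n),
      #{i | x i ≠ y (σ i)} ≤ M * typeDist (inputType x) (inputType y) := by
  obtain ⟨σ, -, hσ⟩ := Finset.exists_min_image (Finset.univ : Finset (Equiv.Perm (Fin n)))
    (fun σ => #{i | x i ≠ y (σ i)}) ⟨1, Finset.mem_univ _⟩
  refine ⟨σ, ?_⟩
  -- Otherwise swapping `i` and `j` repairs `i`, while `j` was already a disagreement, contradicting
  -- minimality of `σ`.
  have hopt : ∀ i j, x i ≠ y (σ i) → y (σ j) = x i → x j = x i := by
    intro i j hi hj
    by_contra hji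
    obtain ⟨ρ, hρ⟩ : ∃ ρ : Equiv.Perm (Fin n), ∀ l, ρ l = σ (Equiv.swap i j l) :=
      ⟨σ * Equiv.swap i j, fun _ => rfl⟩
    have hlt : #{l | x l ≠ y (ρ l)} < #{l | x l ≠ y (σ l)} := by
      refine Finset.card_lt_card ⟨fun l hl => ?_, fun hsub => ?_⟩
      · simp only [Finset.mem_filter, Finset.mem_univ, true_and, hρ] at hl ⊢
        by_cases hli : l = i
        · subst hli; exact hi
        by_cases hlj : l = j
        · subst hlj; rw [hj]; exact hji
        rwa [Equiv.swap_apply_of_ne_of_ne hli hlj] at hl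
      · have := hsub (show i ∈ _ by simpa using hi)
        simp [hρ, hj] at this
    exact absurd (hσ ρ (Finset.mem_univ _)) (not_le.2 hlt)
  have hletter : ∀ a : Fin M, #{i | x i ≠ y (σ i) ∧ x i = a} ≤
      typeDist (inputType x) (inputType y) := by
    intro a
    by_cases hne : ∃ i, x i ≠ y (σ i) ∧ x i = a
    · obtain ⟨i, hi, rfl⟩ := hne
      refine le_trans ?_ (natAbs_count_sub_le_typeDist _ _ (x i))
      rw [← inputType_comp_perm y σ, count_inputType, count_inputType]
      -- By `hopt`, every position where the aligned `y` shows this letter is one where `x` does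
      -- too, so the disagreements number exactly the difference of multiplicities.
      have hunion : #{l | x l ≠ y (σ l) ∧ x l = x i} + #{l | (y ∘ σ) l = x i} =
          #{l | x l = x i} := by
        rw [← Finset.card_union_of_disjoint]
        · congr 1
          ext l
          simp only [Finset.mem_union, Finset.mem_filter, Finset.mem_univ, true_and,
            Function.comp_apply]
          constructor
          · rintro (h | h)
            · exact h.2
            · exact hopt i l hi h
          · intro h
            by_cases hl : y (σ l) = x i
            · exact Or.inr hl
            · exact Or.inl ⟨fun h' => hl (h' ▸ h), h⟩
        · rw [Finset.disjoint_left]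
          intro l hl hl'
          simp only [Finset.mem_filter, Finset.mem_univ, true_and, Function.comp_apply] at hl hl'
          exact hl.1 (hl.2.trans hl'.symm)
      omega
    · rw [Finset.filter_eq_empty_iff.2 fun i _ h => hne ⟨i, h⟩]
      simp
  calc #{i | x i ≠ y (σ i)}
      = ∑ a : Fin M, #{i | x i ≠ y (σ i) ∧ x i = a} := by
        rw [Finset.card_eq_sum_card_fiberwise (f := x) (t := Finset.univ) (by simp)]
        simp only [Finset.filter_filter]
    _ ≤ ∑ _a : Fin M, typeDist (inputType x) (inputType y) :=
        Finset.sum_le_sum fun a _ => hletter a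
    _ = M * typeDist (inputType x) (inputType y) := by simp

theorem exists_letter_card_ge (hM : 0 < M) (x : Fin n → Fin M) :
    ∃ c, n ≤ M * #{i | x i = c} := by
  have : Nonempty (Fin M) := ⟨⟨0, hM⟩⟩
  obtain ⟨c, -, hc⟩ := Finset.exists_max_image (Finset.univ : Finset (Fin M))
    (fun c => #{i | x i = c}) Finset.univ_nonempty
  refine ⟨c, ?_⟩
  have h := Finset.card_eq_sum_card_fiberwise (f := x) (s := Finset.univ) (t := Finset.univ)
    (by simp)
  calc n = ∑ a : Fin M, #{i | x i = a} := by simpa using h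
    _ ≤ ∑ _a : Fin M, #{i | x i = c} := Finset.sum_le_sum fun a ha => hc a ha
    _ = M * #{i | x i = c} := by simp

end Types

/-! ### The lower bound -/

/-- An algorithm cannot tell permutations of `x` from permutations of `y` with few queries when
the types of `x` and `y` are close. -/
theorem Algorithm.exists_perm_amplNorm_sub_sq_le {n M T : ℕ} (A : Algorithm n M T) (hM : 0 < M)
    (x y : Fin n → Fin M) :
    ∃ π ρ : Equiv.Perm (Fin n),
      n * amplNorm (A.state (x ∘ π) T - A.state (y ∘ ρ) T) ^ 2 ≤
        16 * (T : ℝ) ^ 2 * M ^ 2 * typeDist (inputType x) (inputType y) := by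
  obtain ⟨σ, hσ⟩ := exists_perm_card_disagree_le x y
  obtain ⟨c, hc⟩ := exists_letter_card_ge hM x
  set d := typeDist (inputType x) (inputType y)
  set E : Finset (Fin n) := {i | x i ≠ y (σ i)} with hE
  -- The hybrid may lie outside any promise: only its states are used, never the correctness of its
  -- output.
  let z : Fin n → Fin M := fun i => if i ∈ E then c else x i
  set C : Finset (Fin n) := {i | z i = c} with hC
  have hEC : E ⊆ C := fun i hi => by simp [hC, z, hi]
  have hNC : n ≤ M * #C := by
    refine hc.trans (Nat.mul_le_mul_left _ (Finset.card_le_card fun i hi => ?_))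
    have hi' : x i = c := by simpa using hi
    simp [hC, z, hi']
  obtain ⟨D, hDC, hDk, hDle⟩ :=
    exists_subset_card_eq_sum_le (A.queryWeight z) #E C (Finset.card_le_card hEC)
  obtain ⟨π, hfix, hπC, hπE⟩ := exists_perm_maps_subset hDC hEC hDk
  obtain ⟨ρ, hρ⟩ : ∃ ρ : Equiv.Perm (Fin n), ∀ i, ρ i = σ (π i) := ⟨σ * π, fun _ => rfl⟩
  have hz : ∀ i, z (π i) = z i := by
    intro i
    by_cases hi : i ∈ C
    · have h1 : z (π i) = c := by simpa [hC] using (hπC i).2 hi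
      have h2 : z i = c := by simpa [hC] using hi
      rw [h1, h2]
    · rw [hfix i hi]
  have hx : ∀ i, i ∉ D → (x ∘ π) i = z i := by
    intro i hi
    have : π i ∉ E := fun h => hi ((hπE i).1 h)
    rw [← hz i]
    simp [z, this]
  have hy : ∀ i, i ∉ D → (y ∘ ρ) i = z i := by
    intro i hi
    have hn : π i ∉ E := fun h => hi ((hπE i).1 h)
    have hxy : x (π i) = y (σ (π i)) := by simpa [hE] using hn
    rw [← hx i hi, Function.comp_apply, Function.comp_apply, hρ, hxy]
  refine ⟨π, ρ, ?_⟩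
  have h1 := A.amplNorm_state_sub_sq_le (x ∘ π) z D hx
  have h2 := A.amplNorm_state_sub_sq_le (y ∘ ρ) z D hy
  have htri : amplNorm (A.state (x ∘ π) T - A.state (y ∘ ρ) T) ≤
      amplNorm (A.state (x ∘ π) T - A.state z T) +
        amplNorm (A.state (y ∘ ρ) T - A.state z T) := by
    rw [amplNorm_sub_rev (A.state (y ∘ ρ) T)]
    refine le_trans (le_of_eq ?_) (amplNorm_add_le _ _)
    rw [sub_add_sub_cancel]
  have hsq : amplNorm (A.state (x ∘ π) T - A.state (y ∘ ρ) T) ^ 2 ≤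
      16 * T * ∑ i ∈ D, A.queryWeight z i := by
    have := pow_le_pow_left₀ (amplNorm_nonneg _) htri 2
    nlinarith [sq_nonneg (amplNorm (A.state (x ∘ π) T - A.state z T) -
      amplNorm (A.state (y ∘ ρ) T - A.state z T))]
  have hCT : ∑ i ∈ C, A.queryWeight z i ≤ T := by
    rw [← A.sum_queryWeight z]
    exact Finset.sum_le_sum_of_subset_of_nonneg (Finset.subset_univ C)
      fun i _ _ => A.queryWeight_nonneg z i
  have hD0 : 0 ≤ ∑ i ∈ D, A.queryWeight z i :=
    Finset.sum_nonneg fun i _ => A.queryWeight_nonneg z i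
  -- One factor `M` comes from the popular letter, the other from the bound on `#E`.
  have hnD : (n : ℝ) * ∑ i ∈ D, A.queryWeight z i ≤ M ^ 2 * d * T := by
    calc (n : ℝ) * ∑ i ∈ D, A.queryWeight z i
        ≤ (M * #C) * ∑ i ∈ D, A.queryWeight z i := by
          gcongr
          exact_mod_cast hNC
      _ = M * (#C * ∑ i ∈ D, A.queryWeight z i) := by ring
      _ ≤ M * (#E * ∑ i ∈ C, A.queryWeight z i) := by gcongr
      _ ≤ M * ((M * d) * T) := by
          have hσ' : (#E : ℝ) ≤ M * d := by exact_mod_cast hσ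
          gcongr
          exact Finset.sum_nonneg fun i _ => A.queryWeight_nonneg z i
      _ = M ^ 2 * d * T := by ring
  calc n * amplNorm (A.state (x ∘ π) T - A.state (y ∘ ρ) T) ^ 2
      ≤ n * (16 * T * ∑ i ∈ D, A.queryWeight z i) := by gcongr
    _ = 16 * T * (n * ∑ i ∈ D, A.queryWeight z i) := by ring
    _ ≤ 16 * T * (M ^ 2 * d * T) := by gcongr
    _ = 16 * (T : ℝ) ^ 2 * M ^ 2 * d := by ring

theorem IsSymmetricFun.apply_comp {n M : ℕ} {X : Set (Fin n → Fin M)} {f : X → Bool}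
    (hX : IsSymmetricPromise X) (hf : IsSymmetricFun f) (x : X) (σ : Equiv.Perm (Fin n)) :
    f ⟨x.1 ∘ σ, hX x.1 x.2 σ⟩ = f x :=
  hf x _ σ rfl

/-- The query lower bound for a pair of inputs on which a symmetric function differs. -/
theorem Algorithm.Computes.card_le {n M T : ℕ} {A : Algorithm n M T} {X : Set (Fin n → Fin M)}
    {f : X → Bool} (hA : A.Computes f) (hX : IsSymmetricPromise X) (hf : IsSymmetricFun f)
    (hM : 0 < M) (x y : X) (hxy : f x ≠ f y) :
    (n : ℝ) ≤ (20 * T * M) ^ 2 * typeDist (inputType x.1) (inputType y.1) := by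
  obtain ⟨π, ρ, h⟩ := A.exists_perm_amplNorm_sub_sq_le hM x.1 y.1
  have hx := hA ⟨x.1 ∘ π, hX x.1 x.2 π⟩
  have hy := hA ⟨y.1 ∘ ρ, hX y.1 y.2 ρ⟩
  rw [hf.apply_comp hX] at hx hy
  have hfy : f y = !(f x) := by
    revert hxy
    cases f x <;> cases f y <;> simp
  rw [hfy] at hy
  have hd := A.one_fifth_le_amplNorm_sub _ _ _ hx hy
  have hd2 := pow_le_pow_left₀ (by norm_num) hd 2
  have := mul_le_mul_of_nonneg_left hd2 (Nat.cast_nonneg (α := ℝ) n)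
  nlinarith

theorem typeDist_le {n M : ℕ} (x y : Fin n → Fin M) :
    typeDist (inputType x) (inputType y) ≤ n := by
  refine Finset.sup_le fun a _ => ?_
  rw [count_inputType, count_inputType]
  have h1 := Finset.card_le_univ ({i | x i = a} : Finset (Fin n))
  have h2 := Finset.card_le_univ ({i | y i = a} : Finset (Fin n))
  rw [Fintype.card_fin] at h1 h2
  omega

/-- At distance zero the alignment leaves no disagreement, so the inputs are permutations of each
other. -/
theorem IsSymmetricFun.typeDist_pos {n M : ℕ} {X : Set (Fin n → Fin M)} {f : X → Bool}
    (hf : IsSymmetricFun f) (x y : X) (hxy : f x ≠ f y) :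
    0 < typeDist (inputType x.1) (inputType y.1) := by
  obtain ⟨σ, hσ⟩ := exists_perm_card_disagree_le x.1 y.1
  by_contra h0
  rw [not_lt, Nat.le_zero] at h0
  rw [h0, mul_zero, Nat.le_zero, Finset.card_eq_zero, Finset.filter_eq_empty_iff] at hσ
  exact hxy (hf y x σ (funext fun i => not_not.1 (hσ (Finset.mem_univ i))))

theorem exists_minTypeDist_eq {n M : ℕ} {X : Set (Fin n → Fin M)} {f : X → Bool}
    (h : minTypeDist f ≠ ⊤) :
    ∃ x y : X, f x ≠ f y ∧ minTypeDist f = typeDist (inputType x.1) (inputType y.1) := by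
  obtain ⟨x₀, y₀, h₀⟩ : ∃ x y : X, f x ≠ f y := by
    by_contra hne
    push Not at hne
    exact h (le_antisymm le_top
      (le_iInf fun x => le_iInf fun y => le_iInf fun hxy => absurd (hne x y) hxy))
  -- Packing the nested infimum over one nonempty index type lets well-foundedness of `ℕ∞` supply a
  -- minimiser.
  have : Nonempty {p : X × X // f p.1 ≠ f p.2} := ⟨⟨(x₀, y₀), h₀⟩⟩
  obtain ⟨⟨⟨x, y⟩, hp⟩, hmin⟩ := ciInf_mem
    fun p : {p : X × X // f p.1 ≠ f p.2} =>
      (typeDist (inputType p.1.1.1) (inputType p.1.2.1) : ℕ∞)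
  refine ⟨x, y, hp, le_antisymm ?_ ?_⟩
  · exact iInf_le_of_le x (iInf_le_of_le y (iInf_le_of_le hp le_rfl))
  · refine le_iInf fun x' => le_iInf fun y' => le_iInf fun h' => ?_
    have := iInf_le (fun p : {p : X × X // f p.1 ≠ f p.2} =>
      (typeDist (inputType p.1.1.1) (inputType p.1.2.1) : ℕ∞)) ⟨(x', y'), h'⟩
    exact hmin.le.trans this

theorem exists_computes_quantumQueryComplexity {n M : ℕ} {X : Set (Fin n → Fin M)} {f : X → Bool}
    (h : quantumQueryComplexity f ≠ ⊤) :
    ∃ (T : ℕ) (A : Algorithm n M T), A.Computes f ∧ quantumQueryComplexity f = T := by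
  let P : ℕ → Prop := fun T => ∃ A : Algorithm n M T, A.Computes f
  have hne : ∃ T, P T := by
    by_contra hne
    push Not at hne
    exact h (by
      refine le_antisymm le_top (le_iInf fun T => le_iInf fun hT => absurd hT (hne T)))
  classical
  obtain ⟨A, hA⟩ := Nat.find_spec hne
  refine ⟨Nat.find hne, A, hA, le_antisymm ?_ ?_⟩
  · exact iInf_le_of_le _ (iInf_le_of_le ⟨A, hA⟩ le_rfl)
  · refine le_iInf fun T => le_iInf fun hT => ?_
    exact_mod_cast Nat.find_min' hne hT

/-- The lower bound in real arithmetic. -/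
theorem div_rpow_div_le {n d M T : ℕ} (hM : 0 < M) (hd : 0 < d) (hdn : d ≤ n)
    (h : (n : ℝ) ≤ (20 * T * M) ^ 2 * d) :
    1 / 20 * (((n : ℝ) / d) ^ (1 / 4 : ℝ) / M) ≤ T := by
  have hM' : (0 : ℝ) < M := by exact_mod_cast hM
  have hd' : (0 : ℝ) < d := by exact_mod_cast hd
  have h1 : (1 : ℝ) ≤ n / d := by rw [le_div_iff₀ hd', one_mul]; exact_mod_cast hdn
  have h2 : ((n : ℝ) / d) ^ (1 / 4 : ℝ) ≤ 20 * T * M := by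
    -- The only loss from square root to fourth root; it needs `n / d ≥ 1`.
    calc ((n : ℝ) / d) ^ (1 / 4 : ℝ) ≤ ((n : ℝ) / d) ^ (1 / 2 : ℝ) :=
          Real.rpow_le_rpow_of_exponent_le h1 (by norm_num)
      _ = √((n : ℝ) / d) := (Real.sqrt_eq_rpow _).symm
      _ ≤ 20 * T * M := by
          rw [Real.sqrt_le_left (by positivity), div_le_iff₀ hd']
          exact h
  have h3 : ((n : ℝ) / d) ^ (1 / 4 : ℝ) / M ≤ 20 * T := by
    rw [div_le_iff₀ hM']; exact h2
  linarith

end QuantumQuery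

theorem mainTheorem4 :
    ∃ c : ℝ, 0 < c ∧
      ∀ (n M : ℕ) (X : Set (Fin n → Fin M)) (f : X → Bool),
        QuantumQuery.IsSymmetricPromise X → QuantumQuery.IsSymmetricFun f →
          ENNReal.ofReal c * (QuantumQuery.gMeasure f ^ (1 / 4 : ℝ) / (M : ℝ≥0∞)) ≤
            (QuantumQuery.quantumQueryComplexity f : ℝ≥0∞) := by
  refine ⟨1 / 20, by norm_num, fun n M X f hX hf => ?_⟩
  by_cases hconst : QuantumQuery.minTypeDist f = ⊤
  · simp [QuantumQuery.gMeasure, hconst]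
  by_cases hQ : QuantumQuery.quantumQueryComplexity f = ⊤
  · simp [hQ]
  obtain ⟨x, y, hxy, hmin⟩ := QuantumQuery.exists_minTypeDist_eq hconst
  obtain ⟨T, A, hA, hT⟩ := QuantumQuery.exists_computes_quantumQueryComplexity hQ
  have hd := hf.typeDist_pos x y hxy
  have hdn := QuantumQuery.typeDist_le x.1 y.1
  -- Since `0 < d ≤ n`, position `0` exists and its letter inhabits `Fin M`.
  have hM : 0 < M := Nat.pos_of_ne_zero fun h =>
    (Fin.cast h (x.1 ⟨0, hd.trans_le hdn⟩)).elim0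
  have hreal := QuantumQuery.div_rpow_div_le hM hd hdn (hA.card_le hX hf hM x y hxy)
  rw [QuantumQuery.gMeasure, hmin, hT]
  have hd' : (0 : ℝ) < QuantumQuery.typeDist (QuantumQuery.inputType x.1)
      (QuantumQuery.inputType y.1) := by exact_mod_cast hd
  have hM' : (0 : ℝ) < M := by exact_mod_cast hM
  have h := ENNReal.ofReal_le_ofReal hreal
  rw [ENNReal.ofReal_mul (by norm_num), ENNReal.ofReal_div_of_pos hM',
    ← ENNReal.ofReal_rpow_of_nonneg (by positivity) (by norm_num),
    ENNReal.ofReal_div_of_pos hd'] at h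
  simpa only [ENNReal.ofReal_natCast, ENat.toENNReal_coe] using h
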